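/- Let $d\ge 0$ and let $\mathbb{C}\langle x_1,\dots,x_d\rangle$ be the polynomials in non-commuting variables, with the conjugate-linear involution $x_{u(1)}\cdots x_{u(k)}\mapsto x_{u(k)}\cdots x_{u(1)}$. For a multi-index $\vec u=(u(1),\dots,u(k))\in\{1,\dots,d\}^k$, $k\ge 0$, put $x_{\vec u}=x_{u(1)}\cdots x_{u(k)}$ and $|\vec u|=k$. A *state* is a linear functional $\phi$ with $\phi[1]=1$, $\phi[X^*]=\overline{\phi[X]}$ and $\phi[X^*X]\ge 0$ for all $X$. A *monic orthogonal polynomial system* (MOPS) of a linear functional $\phi$ is a family $\{P_{\vec u}\}$ with $P_{\vec u}=x_{\vec u}+{}$(terms of degree $<|\vec u|$), $P_\emptyset=1$, and $\phi[P_{\vec u}^*P_{\vec v}]=0$ for $\vec u\ne\vec v$. Let $\mathcal{T}_i^{(k)}=(B_{i,\vec w,\vec u})_{|\vec w|=|\vec u|=k}$ ($1\le i\le d$, $k\ge 0$) be complex $d^k\times d^k$ matrices and $\mathcal{C}^{(k)}=\mathrm{diag}(\mathcal{C}_{\vec u})_{|\vec u|=k}$ ($k\ge 1$) non-negative diagonal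 matrices such that $(\mathcal{T}_i^{(k)})^*\mathcal{K}^{(k)}=\mathcal{K}^{(k)}\mathcal{T}_i^{(k)}$ for all $i,k$, where $\mathcal{K}^{(k)}$ is the diagonal matrix with entries $\mathcal{K}_{\vec u}=\mathcal{C}_{(u(1),\dots,u(k))}\,\mathcal{C}_{(u(2),\dots,u(k))}\cdots\mathcal{C}_{(u(k))}$, $\mathcal{K}_\emptyset=1$. We call $(\mathcal{T},\mathcal{C})$ *recursion coefficients* of $\phi$ if some MOPS of $\phi$ satisfies, for all $i$ and $\vec u$, $$x_iP_{\vec u}=P_{(i,\vec u)}+\sum_{|\vec w|=|\vec u|}B_{i,\vec w,\vec u}P_{\vec w}+\delta_{i,u(1)}\,\mathcal{C}_{\vec u}\,P_{(u(2),\dots,u(k))},$$ the last term being absent for $\vec u=\emptyset$. The Boolean cumulants of $\phi$ are defined recursively for $n\ge 1$ by $\phi[x_{\vec u}]=\sum_{\pi}\prod_{B\in\pi}\eta_\phi\bigl[\prod_{i\in B}x_{u(i)}\bigr]$, $|\vec u|=n$, with the sum over all partitions $\pi$ of $\{1,\dots,n\}$ into intervals. For real $t$, the Boolean convolution power $\phi^{\uplus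 t}$ is the unital linear functional with $\eta_{\phi^{\uplus t}}=t\,\eta_\phi$. **Statement.** Let $\phi$ be a state on $\mathbb{C}\langle x_1,\dots,x_d\rangle$ with a MOPS. Then $\phi$ has recursion coefficients, and for every real $t\ge 0$ the functional $\phi^{\uplus t}$ is a state with a MOPS. If $(\mathcal{T},\mathcal{C})$ are recursion coefficients of $\phi$, then recursion coefficients of $\phi^{\uplus t}$ are obtained from them by multiplying each $\mathcal{T}_i^{(0)}$ and $\mathcal{C}^{(1)}$ by $t$ and leaving all other $\mathcal{T}_i^{(k)}$, $\mathcal{C}^{(k)}$ unchanged. For $t>0$ the converse also holds: for any matrices $\mathcal{T}_i^{(k)}$ and diagonal matrices $\mathcal{C}^{(k)}$ with real entries, if the matrices so rescaled are recursion coefficients of $\phi^{\uplus t}$, then the original ones are recursion coefficients of $\phi$. -/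

import Mathlib

open scoped Matrix

namespace BooleanPower

noncomputable section

/-- Complex polynomials in `d` non-commuting variables. -/
abbrev NCPoly (d : ℕ) := FreeAlgebra ℂ (Fin d)

/-- The variable `x_i`. -/
def var {d : ℕ} (i : Fin d) : NCPoly d := FreeAlgebra.ι ℂ i

/-- The monomial `x_{u(1)} x_{u(2)} ⋯ x_{u(n)}` of a multi-index `u` of length `n`. -/
def mono {d n : ℕ} (u : Fin n → Fin d) : NCPoly d :=
  (List.ofFn fun j => var (u j)).prod

theorem basis_eq_mono {d : ℕ} (w : FreeMonoid (Fin d)) :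
    FreeAlgebra.basisFreeMonoid ℂ (Fin d) w = mono w.toList.get := by
  have h1 : FreeAlgebra.basisFreeMonoid ℂ (Fin d) w =
      FreeMonoid.lift (FreeAlgebra.ι ℂ) w := by
    simp [FreeAlgebra.basisFreeMonoid, FreeAlgebra.equivMonoidAlgebraFreeMonoid]
  have h2 : (List.ofFn fun j => var (w.toList.get j)) = w.toList.map (FreeAlgebra.ι ℂ) := by
    change List.ofFn ((FreeAlgebra.ι ℂ : Fin d → NCPoly d) ∘ w.toList.get) = _
    rw [← List.map_ofFn, List.ofFn_get]
  rw [h1, mono, h2, FreeMonoid.lift_apply]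

theorem mono_eq_basis {d n : ℕ} (u : Fin n → Fin d) :
    mono u = FreeAlgebra.basisFreeMonoid ℂ (Fin d) (FreeMonoid.ofList (List.ofFn u)) := by
  have h1 : FreeAlgebra.basisFreeMonoid ℂ (Fin d) (FreeMonoid.ofList (List.ofFn u)) =
      FreeMonoid.lift (FreeAlgebra.ι ℂ) (FreeMonoid.ofList (List.ofFn u)) := by
    simp [FreeAlgebra.basisFreeMonoid, FreeAlgebra.equivMonoidAlgebraFreeMonoid]
  rw [h1, FreeMonoid.lift_apply, mono, FreeMonoid.toList_ofList, List.map_ofFn]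
  rfl

/-- The conjugate-linear involution with `(α x_u)^* = conj α x_{u^op}`; each `x_i` is
self-adjoint.  (Mathlib's `star` on `FreeAlgebra` does not conjugate scalars.) -/
def adj {d : ℕ} (p : NCPoly d) : NCPoly d :=
  ((FreeAlgebra.basisFreeMonoid ℂ (Fin d)).repr p).sum fun w a =>
    (starRingEnd ℂ a) • FreeAlgebra.basisFreeMonoid ℂ (Fin d) w.reverse

theorem adj_add {d : ℕ} (p q : NCPoly d) : adj (p + q) = adj p + adj q := by
  unfold adj
  rw [map_add, Finsupp.sum_add_index' (by simp) (by simp [add_smul])]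

theorem adj_smul_mono {d n : ℕ} (a : ℂ) (u : Fin n → Fin d) :
    adj (a • mono u) = (starRingEnd ℂ a) • mono (fun j => u j.rev) := by
  have h : List.ofFn (fun j => u j.rev) = (List.ofFn u).reverse := by
    apply List.ext_getElem
    · simp
    · intro k h1 h2
      simp only [List.getElem_ofFn, List.getElem_reverse, List.length_ofFn]
      congr 1
      ext
      simp
      omega
  rw [mono_eq_basis, mono_eq_basis, h, adj, map_smul, Module.Basis.repr_self,
    Finsupp.smul_single, Finsupp.sum_single_index (by simp)]
  simp [FreeMonoid.reverse]
  rfl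

open scoped ComplexOrder in
/-- States: unital, hermitian, positive linear functionals on non-commutative polynomials. -/
structure IsState {d : ℕ} (φ : NCPoly d →ₗ[ℂ] ℂ) : Prop where
  unital : φ 1 = 1
  hermitian : ∀ X, φ (adj X) = starRingEnd ℂ (φ X)
  positive : ∀ X, 0 ≤ φ (adj X * X)

/-- A family of polynomials indexed by all multi-indices `u ∈ {1,…,d}^k`, `k ≥ 0`. -/
abbrev PolyFamily (d : ℕ) := (k : ℕ) → (Fin k → Fin d) → NCPoly d

/-- `P_u = x_u + ` lower-order terms, that is, `P_u - x_u` is a combination of monomials of degree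
smaller than the length of `u`; for the empty multi-index this says `P_∅ = 1`. -/
def IsMonicFamily {d : ℕ} (P : PolyFamily d) : Prop :=
  ∀ (k : ℕ) (u : Fin k → Fin d),
    P k u - mono u ∈ Submodule.span ℂ {p | ∃ (l : ℕ) (v : Fin l → Fin d), l < k ∧ p = mono v}

/-- A monic orthogonal polynomial system of `φ`: a monic family with `⟨P_u, P_v⟩_φ = φ[P_u^* P_v] = 0`
for all distinct multi-indices `u`, `v`. -/
structure IsMOPS {d : ℕ} (φ : NCPoly d →ₗ[ℂ] ℂ) (P : PolyFamily d) : Prop where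
  monic : IsMonicFamily P
  orthogonal : ∀ (k l : ℕ) (u : Fin k → Fin d) (v : Fin l → Fin d),
    (⟨k, u⟩ : Σ n, Fin n → Fin d) ≠ ⟨l, v⟩ → φ (adj (P k u) * P l v) = 0

def HasMOPS {d : ℕ} (φ : NCPoly d →ₗ[ℂ] ℂ) : Prop := ∃ P, IsMOPS φ P

/-- The `d^k × d^k` matrices `T_i^{(k)}`, `1 ≤ i ≤ d`, `k ≥ 0`; the entry `T i k w u` is
`B_{i,w,u}`. -/
abbrev TCoeff (d : ℕ) := Fin d → (k : ℕ) → Matrix (Fin k → Fin d) (Fin k → Fin d) ℂ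

/-- The diagonals of the `d^k × d^k` diagonal matrices `C^{(k)}`, `k ≥ 1` (the value at `k = 0`
plays no role). -/
abbrev CCoeff (d : ℕ) := (k : ℕ) → (Fin k → Fin d) → ℝ

/-- The diagonal of `K_C^{(k)} = (I ⊗ ⋯ ⊗ I ⊗ C^{(1)}) ⋯ (I ⊗ C^{(k-1)}) C^{(k)}`. -/
def kernelC {d : ℕ} (C : CCoeff d) : (k : ℕ) → (Fin k → Fin d) → ℝ
  | 0, _ => 1
  | k + 1, u => kernelC C k (Fin.tail u) * C (k + 1) u

/-- The three-term recursion
`x_i P_u = P_{(i,u)} + ∑_{|w| = |u|} B_{i,w,u} P_w + δ_{i,u(1)} C_u P_{(u(2),…,u(k))}`,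
without the last term if `u` is empty. -/
structure SatisfiesRecursion {d : ℕ} (T : TCoeff d) (C : CCoeff d) (P : PolyFamily d) : Prop where
  zero : ∀ (i : Fin d) (u : Fin 0 → Fin d),
    var i * P 0 u = P 1 (Fin.cons i u) + ∑ w : Fin 0 → Fin d, T i 0 w u • P 0 w
  succ : ∀ (i : Fin d) (k : ℕ) (u : Fin (k + 1) → Fin d),
    var i * P (k + 1) u = P (k + 2) (Fin.cons i u)
      + ∑ w : Fin (k + 1) → Fin d, T i (k + 1) w u • P (k + 1) w
      + if i = u 0 then (C (k + 1) u : ℂ) • P k (Fin.tail u) else 0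

/-- `T`, `C` are the coefficients in the recursion relation for a MOPS of `φ`: each `C^{(k)}` is
diagonal and non-negative, `(T_i^{(k)})^* K_C^{(k)} = K_C^{(k)} T_i^{(k)}`, and some MOPS of `φ`
satisfies the recursion with these coefficients. -/
structure IsRecursionCoeff {d : ℕ} (φ : NCPoly d →ₗ[ℂ] ℂ) (T : TCoeff d) (C : CCoeff d) :
    Prop where
  nonneg : ∀ (k : ℕ) (u : Fin (k + 1) → Fin d), 0 ≤ C (k + 1) u
  comm : ∀ (i : Fin d) (k : ℕ),
    (T i k)ᴴ * Matrix.diagonal (fun u => (kernelC C k u : ℂ)) =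
      Matrix.diagonal (fun u => (kernelC C k u : ℂ)) * T i k
  recursion : ∃ P, IsMOPS φ P ∧ SatisfiesRecursion T C P

/-- Multiply each `T_i^{(0)}` by `t`. -/
def scaleT {d : ℕ} (t : ℝ) (T : TCoeff d) : TCoeff d :=
  fun i k => if k = 0 then (t : ℂ) • T i k else T i k

/-- Multiply `C^{(1)}` by `t`. -/
def scaleC {d : ℕ} (t : ℝ) (C : CCoeff d) : CCoeff d :=
  fun k u => if k = 1 then t * C k u else C k u

/-- The Boolean cumulant `η[x_u]` of a functional, `u` of length `n`.  Interval partitions of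
`{1,…,n}` are compositions of `n`; the block number `j` of `c` has `c.blocksFun j` elements and
`c.embedding j` lists them in increasing order. -/
def boolCumulant {d : ℕ} (φ : NCPoly d →ₗ[ℂ] ℂ) : (n : ℕ) → (Fin n → Fin d) → ℂ
  | 0, _ => 0
  | n + 1, u => φ (mono u) -
      ∑ c : {c : Composition (n + 1) // c ≠ Composition.single (n + 1) n.succ_pos},
        ∏ j : Fin c.1.length, boolCumulant φ (c.1.blocksFun j) (u ∘ c.1.embedding j)
  termination_by n => n
  decreasing_by exact (Composition.ne_single_iff n.succ_pos).1 c.2 j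

/-- The linear functional with given moments `φ[x_u] = m n u`, `u` of length `n`. -/
def ofMoments {d : ℕ} (m : (n : ℕ) → (Fin n → Fin d) → ℂ) : NCPoly d →ₗ[ℂ] ℂ :=
  (FreeAlgebra.basisFreeMonoid ℂ (Fin d)).constr ℂ fun w => m w.toList.length w.toList.get

/-- The Boolean convolution power `φ^{⊎ t}`: the unital linear functional with Boolean cumulants
`t η_φ` (see `boolCumulant_boolConvPow` and `eq_boolConvPow`); its moments are
`φ^{⊎ t}[x_u] = ∑_π ∏_{B ∈ π} t η_φ[x_{u|B}]`, summed over all interval partitions `π`. -/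
def boolConvPow {d : ℕ} (φ : NCPoly d →ₗ[ℂ] ℂ) (t : ℝ) : NCPoly d →ₗ[ℂ] ℂ :=
  ofMoments fun n u => ∑ c : Composition n,
    ∏ j : Fin c.length, (t : ℂ) * boolCumulant φ (c.blocksFun j) (u ∘ c.embedding j)

theorem ofMoments_mono {d : ℕ} (m : (n : ℕ) → (Fin n → Fin d) → ℂ) {n : ℕ} (u : Fin n → Fin d) :
    ofMoments m (mono u) = m n u := by
  rw [mono_eq_basis, ofMoments, Module.Basis.constr_basis]
  have key : ∀ (l : ℕ) (h : l = n) (v : Fin l → Fin d), (∀ j, v j = u (Fin.cast h j)) →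
      m l v = m n u := by
    intro l h v hv
    subst h
    exact congrArg _ (funext hv)
  refine key _ (by simp) _ fun j => ?_
  exact List.get_ofFn u j

theorem prod_single {d n : ℕ} (f : (n : ℕ) → (Fin n → Fin d) → ℂ) (h : 0 < n)
    (u : Fin n → Fin d) :
    ∏ j : Fin (Composition.single n h).length,
      f ((Composition.single n h).blocksFun j) (u ∘ (Composition.single n h).embedding j) =
      f n u := by
  have key : ∀ (l : ℕ) (e : l = n) (v : Fin l → Fin d), (∀ j, v j = u (Fin.cast e j)) →
      f l v = f n u := by
    intro l e v hv
    subst e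
    exact congrArg _ (funext hv)
  change ∏ j : Fin 1, _ = _
  rw [Fin.prod_univ_one]
  refine key _ (Composition.single_blocksFun h _) _ fun j => ?_
  exact congrArg u (Composition.single_embedding h _)

theorem sum_composition_split {d n : ℕ} (f : (n : ℕ) → (Fin n → Fin d) → ℂ) (h : 0 < n)
    (u : Fin n → Fin d) :
    ∑ c : Composition n, ∏ j : Fin c.length, f (c.blocksFun j) (u ∘ c.embedding j) =
      f n u + ∑ c : {c : Composition n // c ≠ Composition.single n h},
        ∏ j : Fin c.1.length, f (c.1.blocksFun j) (u ∘ c.1.embedding j) := by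
  rw [Fintype.sum_eq_add_sum_subtype_ne _ (Composition.single n h), prod_single f h u]

/-- The moment-cumulant formula over all interval partitions. -/
theorem moment_eq_sum_boolCumulant {d n : ℕ} (φ : NCPoly d →ₗ[ℂ] ℂ) (h1 : φ 1 = 1)
    (u : Fin n → Fin d) :
    φ (mono u) = ∑ c : Composition n,
      ∏ j : Fin c.length, boolCumulant φ (c.blocksFun j) (u ∘ c.embedding j) := by
  cases n with
  | zero =>
    have : ∀ c : Composition 0, ∏ j : Fin c.length,
        boolCumulant φ (c.blocksFun j) (u ∘ c.embedding j) = 1 := by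
      intro c
      have hc : c.length = 0 := Nat.le_zero.1 c.length_le
      have : IsEmpty (Fin c.length) := by rw [hc]; infer_instance
      exact Finset.prod_of_isEmpty _
    simp only [this, Finset.sum_const, Finset.card_univ, composition_card]
    simp [mono, h1]
  | succ n =>
    rw [sum_composition_split (boolCumulant φ) n.succ_pos u, boolCumulant]
    ring

theorem boolConvPow_one {d : ℕ} (φ : NCPoly d →ₗ[ℂ] ℂ) (t : ℝ) : boolConvPow φ t 1 = 1 := by
  have h : (1 : NCPoly d) = mono (Fin.elim0 : Fin 0 → Fin d) := by simp [mono]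
  rw [h, boolConvPow, ofMoments_mono]
  have : ∀ c : Composition 0, ∏ j : Fin c.length,
      (t : ℂ) * boolCumulant φ (c.blocksFun j) (Fin.elim0 ∘ c.embedding j) = 1 := by
    intro c
    have hc : c.length = 0 := Nat.le_zero.1 c.length_le
    have : IsEmpty (Fin c.length) := by rw [hc]; infer_instance
    exact Finset.prod_of_isEmpty _
  simp only [this, Finset.sum_const, Finset.card_univ, composition_card]
  simp

/-- `η_{φ^{⊎ t}} = t η_φ`. -/
theorem boolCumulant_boolConvPow {d : ℕ} (φ : NCPoly d →ₗ[ℂ] ℂ) (t : ℝ) (n : ℕ)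
    (u : Fin n → Fin d) :
    boolCumulant (boolConvPow φ t) n u = t * boolCumulant φ n u := by
  induction n using Nat.strong_induction_on with
  | _ n ih =>
    cases n with
    | zero => simp [boolCumulant]
    | succ n =>
      rw [boolCumulant, boolConvPow, ofMoments_mono,
        sum_composition_split (fun n u => (t : ℂ) * boolCumulant φ n u) n.succ_pos u,
        ← boolConvPow, sub_eq_iff_eq_add]
      congr 1
      refine Finset.sum_congr rfl fun c _ => Finset.prod_congr rfl fun j _ => ?_
      exact (ih _ ((Composition.ne_single_iff n.succ_pos).1 c.2 j) _).symm

/-- A unital linear functional is determined by its Boolean cumulants; so `φ^{⊎ t}` is the only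
unital functional with Boolean cumulants `t η_φ`. -/
theorem eq_boolConvPow {d : ℕ} (φ ψ : NCPoly d →ₗ[ℂ] ℂ) (t : ℝ) (h1 : ψ 1 = 1)
    (h : ∀ (n : ℕ) (u : Fin n → Fin d), boolCumulant ψ n u = t * boolCumulant φ n u) :
    ψ = boolConvPow φ t := by
  refine (FreeAlgebra.basisFreeMonoid ℂ (Fin d)).ext fun w => ?_
  rw [basis_eq_mono, moment_eq_sum_boolCumulant ψ h1, boolConvPow, ofMoments_mono]
  simp only [h]

end

end BooleanPower

namespace BooleanPower

noncomputable section

/-! ### The involution and monomials -/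

/-! Coefficients `T`, `C` define operators X_i = creation + preservation + annihilation on the
algebraic full Fock space, with the form ⟨e_u, e_v⟩ = δ_{u,v} K_u. Non-negativity of `C` makes the
form positive and the commutation relation makes each X_i symmetric, so the vacuum functional
`fockState T C` is a state. The polynomials solving the recursion send the vacuum Ω to the basis
vectors e_u, hence are orthogonal. Conversely, a unital functional with these recursion coefficients
must be that vacuum functional (`isRecursionCoeff_iff`), so everything reduces to vacuum
functionals.

Let Q project onto the complement of Ω. Splitting a path according to its returns to Ω shows that
the Boolean cumulant of x_{u(1)}⋯x_{u(n)} is the vacuum coefficient of X_{u(1)} Q X_{u(2)} Q ⋯ Q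
X_{u(n)} Ω (`boolCumulant_fockState`). The entries of T^{(0)} and C^{(1)} are exactly those leading
into Ω. Multiplying them by t leaves every Q X_i unchanged and multiplies the vacuum component of
X_i v by t; only the leftmost variable is uncut, so each cumulant gains one factor t
(`fockState_scale`). For t > 0, rescaling by t⁻¹ gives the converse.

For existence, `T` and `C` are read off from inner products of the given MOPS. Since φ may be
degenerate, that MOPS satisfies the recursion only modulo the left ideal of null polynomials. This
still forces φ to be the vacuum functional (`IsMOPS.eq_fockState`), and the exact solution of the
recursion is then another MOPS of φ. -/

theorem basis_induction {d : ℕ} {motive : NCPoly d → Prop} (zero : motive 0)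
    (add : ∀ p q, motive p → motive q → motive (p + q))
    (smul : ∀ (a : ℂ) p, motive p → motive (a • p))
    (basis : ∀ w, motive (FreeAlgebra.basisFreeMonoid ℂ (Fin d) w)) (p : NCPoly d) :
    motive p := by
  have h := (FreeAlgebra.basisFreeMonoid ℂ (Fin d)).mem_span p
  induction h using Submodule.span_induction with
  | mem p hp =>
    obtain ⟨w, rfl⟩ := hp
    exact basis w
  | zero => exact zero
  | add p q _ _ hp hq => exact add p q hp hq
  | smul a p _ hp => exact smul a p hp

/-- The involution as a conjugate-linear map. -/
def adjₗ (d : ℕ) : NCPoly d →ₛₗ[starRingEnd ℂ] NCPoly d where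
  toFun := adj
  map_add' := adj_add
  map_smul' a p := by
    unfold adj
    rw [map_smul, Finsupp.sum_smul_index (by simp), Finsupp.smul_sum]
    simp [mul_smul]

theorem adjₗ_apply {d : ℕ} (p : NCPoly d) : adjₗ d p = adj p := rfl

theorem adj_smul {d : ℕ} (a : ℂ) (p : NCPoly d) : adj (a • p) = starRingEnd ℂ a • adj p :=
  (adjₗ d).map_smulₛₗ a p

theorem adj_basis {d : ℕ} (w : FreeMonoid (Fin d)) :
    adj (FreeAlgebra.basisFreeMonoid ℂ (Fin d) w) =
      FreeAlgebra.basisFreeMonoid ℂ (Fin d) w.reverse := by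
  rw [adj, Module.Basis.repr_self, Finsupp.sum_single_index (by simp)]
  simp

theorem basis_mul {d : ℕ} (v w : FreeMonoid (Fin d)) :
    FreeAlgebra.basisFreeMonoid ℂ (Fin d) (v * w) =
      FreeAlgebra.basisFreeMonoid ℂ (Fin d) v * FreeAlgebra.basisFreeMonoid ℂ (Fin d) w := by
  simp [FreeAlgebra.basisFreeMonoid, FreeAlgebra.equivMonoidAlgebraFreeMonoid]

theorem adj_mul {d : ℕ} (p q : NCPoly d) : adj (p * q) = adj q * adj p := by
  simp only [← adjₗ_apply]
  induction p using basis_induction with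
  | zero => simp
  | add p p' hp hp' => simp [add_mul, mul_add, hp, hp']
  | smul a p hp => simp [hp]
  | basis v =>
    induction q using basis_induction with
    | zero => simp
    | add p p' hp hp' => simp [add_mul, mul_add, hp, hp']
    | smul a p hp => simp [hp]
    | basis w =>
      simp only [adjₗ_apply, adj_basis, ← basis_mul, FreeMonoid.reverse_mul]

theorem adj_one {d : ℕ} : adj (1 : NCPoly d) = 1 := by
  have h : FreeAlgebra.basisFreeMonoid ℂ (Fin d) 1 = 1 := by
    simp [FreeAlgebra.basisFreeMonoid, FreeAlgebra.equivMonoidAlgebraFreeMonoid]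
  rw [← h, adj_basis]
  rfl

theorem adj_var {d : ℕ} (i : Fin d) : adj (var i) = var i := by
  have h : FreeAlgebra.basisFreeMonoid ℂ (Fin d) (FreeMonoid.of i) = var i := by
    simp [FreeAlgebra.basisFreeMonoid, FreeAlgebra.equivMonoidAlgebraFreeMonoid, var]
  rw [← h, adj_basis]
  rfl

theorem adj_adj {d : ℕ} (p : NCPoly d) : adj (adj p) = p := by
  simp only [← adjₗ_apply]
  induction p using basis_induction with
  | zero => simp
  | add p p' hp hp' => simp [hp, hp']
  | smul a p hp => simp [hp]
  | basis v => simp only [adjₗ_apply, adj_basis, FreeMonoid.reverse_reverse]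

theorem mono_zero {d : ℕ} (u : Fin 0 → Fin d) : mono u = 1 := by simp [mono]

theorem var_mul_mono {d k : ℕ} (i : Fin d) (u : Fin k → Fin d) :
    var i * mono u = mono (Fin.cons i u) := by
  simp [mono, List.ofFn_succ]

/-- Polynomials of degree less than `k`. -/
def degreeLT (d k : ℕ) : Submodule ℂ (NCPoly d) :=
  Submodule.span ℂ {p | ∃ (l : ℕ) (v : Fin l → Fin d), l < k ∧ p = mono v}

theorem mono_mem_degreeLT {d l k : ℕ} (h : l < k) (v : Fin l → Fin d) : mono v ∈ degreeLT d k :=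
  Submodule.subset_span ⟨l, v, h, rfl⟩

theorem degreeLT_mono {d k l : ℕ} (h : k ≤ l) : degreeLT d k ≤ degreeLT d l :=
  Submodule.span_mono fun _ ⟨m, v, hm, hp⟩ => ⟨m, v, hm.trans_le h, hp⟩

theorem var_mul_mem_degreeLT {d k : ℕ} (i : Fin d) {p : NCPoly d} (hp : p ∈ degreeLT d k) :
    var i * p ∈ degreeLT d (k + 1) := by
  induction hp using Submodule.span_induction with
  | mem p hp =>
    obtain ⟨l, v, hl, rfl⟩ := hp
    rw [var_mul_mono]
    exact mono_mem_degreeLT (by omega) _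
  | zero => simp
  | add p q _ _ hp hq => rw [mul_add]; exact add_mem hp hq
  | smul a p _ hp => rw [mul_smul_comm]; exact Submodule.smul_mem _ _ hp

theorem exists_mem_degreeLT {d : ℕ} (p : NCPoly d) : ∃ k, p ∈ degreeLT d k := by
  induction p using basis_induction with
  | zero => exact ⟨0, zero_mem _⟩
  | add p q hp hq =>
    obtain ⟨k, hk⟩ := hp
    obtain ⟨l, hl⟩ := hq
    exact ⟨max k l, add_mem (degreeLT_mono (le_max_left _ _) hk)
      (degreeLT_mono (le_max_right _ _) hl)⟩
  | smul a p hp => exact hp.imp fun k hk => Submodule.smul_mem _ _ hk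
  | basis w => exact ⟨_, basis_eq_mono w ▸ mono_mem_degreeLT (Nat.lt_succ_self _) _⟩

/-! ### Monic families as spanning sets -/

namespace IsMonicFamily

variable {d : ℕ} {P : PolyFamily d}

theorem sub_mono_mem (hP : IsMonicFamily P) {k : ℕ} (u : Fin k → Fin d) :
    P k u - mono u ∈ degreeLT d k := hP k u

theorem zero_eq_one (hP : IsMonicFamily P) (u : Fin 0 → Fin d) : P 0 u = 1 := by
  have h := hP 0 u
  have h0 : {p : NCPoly d | ∃ (l : ℕ) (v : Fin l → Fin d), l < 0 ∧ p = mono v} = ∅ := by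
    ext; simp
  rw [h0, Submodule.span_empty, Submodule.mem_bot, sub_eq_zero] at h
  rw [h, mono_zero]

theorem var_mul_sub_mem (hP : IsMonicFamily P) (i : Fin d) {k : ℕ} (u : Fin k → Fin d) :
    var i * P k u - P (k + 1) (Fin.cons i u) ∈ degreeLT d (k + 1) := by
  have h1 := var_mul_mem_degreeLT i (hP.sub_mono_mem u)
  have h2 := hP.sub_mono_mem (Fin.cons i u : Fin (k + 1) → Fin d)
  rw [mul_sub, var_mul_mono] at h1
  simpa using sub_mem h1 h2

/-- Triangularity: each monomial equals the monic polynomial of the same index up to lower degree,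
which the induction hypothesis covers. -/
theorem degreeLT_le_span (hP : IsMonicFamily P) (k : ℕ) :
    degreeLT d k ≤ Submodule.span ℂ {p | ∃ (l : ℕ) (v : Fin l → Fin d), l < k ∧ p = P l v} := by
  induction k with
  | zero => exact Submodule.span_mono fun p ⟨l, v, hl, _⟩ => absurd hl (Nat.not_lt_zero l)
  | succ k ih =>
    have hle : degreeLT d k ≤
        Submodule.span ℂ {p | ∃ (l : ℕ) (v : Fin l → Fin d), l < k + 1 ∧ p = P l v} :=
      ih.trans (Submodule.span_mono fun p ⟨l, v, hl, hp⟩ => ⟨l, v, by omega, hp⟩)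
    refine Submodule.span_le.2 ?_
    rintro _ ⟨l, v, hl, rfl⟩
    have hs := hle (degreeLT_mono (Nat.lt_succ_iff.1 hl) (hP.sub_mono_mem v))
    have hv : P l v ∈
        Submodule.span ℂ {p | ∃ (l : ℕ) (v : Fin l → Fin d), l < k + 1 ∧ p = P l v} :=
      Submodule.subset_span ⟨l, v, hl, rfl⟩
    simpa using sub_mem hv hs

/-- Induction along a monic family: it spans all polynomials. -/
theorem induction (hP : IsMonicFamily P) {motive : NCPoly d → Prop} (zero : motive 0)
    (add : ∀ p q, motive p → motive q → motive (p + q))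
    (smul : ∀ (a : ℂ) p, motive p → motive (a • p))
    (family : ∀ k u, motive (P k u)) (p : NCPoly d) : motive p := by
  obtain ⟨k, hk⟩ := exists_mem_degreeLT p
  have h := hP.degreeLT_le_span k hk
  clear hk
  induction h using Submodule.span_induction with
  | mem p hp =>
    obtain ⟨l, v, _, rfl⟩ := hp
    exact family l v
  | zero => exact zero
  | add p q _ _ hp hq => exact add p q hp hq
  | smul a p _ hp => exact smul a p hp

end IsMonicFamily

end

noncomputable section

/-! ### The Fock space representation -/

/-- The algebraic full Fock space, with a basis indexed by all multi-indices. -/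
abbrev Fock (d : ℕ) := (Σ n, Fin n → Fin d) →₀ ℂ

/-- The basis vectors of the Fock space. -/
def fockVec {d k : ℕ} (u : Fin k → Fin d) : Fock d := Finsupp.single ⟨k, u⟩ 1

/-- The vacuum vector. -/
def vacuum (d : ℕ) : Fock d := fockVec (Fin.elim0 : Fin 0 → Fin d)

/-- The coefficient of the vacuum vector. -/
def vacuumCoeff (d : ℕ) : Fock d →ₗ[ℂ] ℂ := Finsupp.lapply ⟨0, Fin.elim0⟩

theorem fockVec_zero {d : ℕ} (u : Fin 0 → Fin d) : fockVec u = vacuum d := by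
  rw [Subsingleton.elim u Fin.elim0, vacuum]

theorem vacuumCoeff_vacuum {d : ℕ} : vacuumCoeff d (vacuum d) = 1 := by
  simp [vacuumCoeff, vacuum, fockVec]

theorem vacuumCoeff_fockVec_succ {d k : ℕ} (u : Fin (k + 1) → Fin d) :
    vacuumCoeff d (fockVec u) = 0 := by
  rw [vacuumCoeff, fockVec, Finsupp.lapply_apply, Finsupp.single_apply, if_neg]
  intro h
  exact absurd (congrArg Sigma.fst h) (Nat.succ_ne_zero k)

/-- A linear map on the Fock space with given values on the basis. -/
def fockLift {d : ℕ} {M : Type*} [AddCommGroup M] [Module ℂ M]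
    (f : (k : ℕ) → (Fin k → Fin d) → M) : Fock d →ₗ[ℂ] M :=
  Finsupp.linearCombination ℂ fun x => f x.1 x.2

theorem fockLift_fockVec {d k : ℕ} {M : Type*} [AddCommGroup M] [Module ℂ M]
    (f : (k : ℕ) → (Fin k → Fin d) → M) (u : Fin k → Fin d) :
    fockLift f (fockVec u) = f k u := by
  simp [fockLift, fockVec]

theorem Fock.induction {d : ℕ} {motive : Fock d → Prop} (zero : motive 0)
    (add : ∀ v w, motive v → motive w → motive (v + w))
    (smul : ∀ (a : ℂ) v, motive v → motive (a • v))
    (fockVec : ∀ (k : ℕ) (u : Fin k → Fin d), motive (fockVec u)) (v : Fock d) : motive v := by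
  induction v using Finsupp.induction_linear with
  | zero => exact zero
  | add v w hv hw => exact add v w hv hw
  | single x a =>
    have h := smul a _ (fockVec x.1 x.2)
    rwa [BooleanPower.fockVec, Finsupp.smul_single, smul_eq_mul, mul_one] at h

/-- The creation operator. -/
def creation {d : ℕ} (i : Fin d) : Fock d →ₗ[ℂ] Fock d :=
  fockLift fun k u => fockVec (Fin.cons i u : Fin (k + 1) → Fin d)

/-- The preservation operator with matrices `T_i^{(k)}`. -/
def preservation {d : ℕ} (T : TCoeff d) (i : Fin d) : Fock d →ₗ[ℂ] Fock d :=
  fockLift fun k u => ∑ w : Fin k → Fin d, T i k w u • fockVec w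

/-- The annihilation operator on basis vectors. -/
def annihilationVec {d : ℕ} (C : CCoeff d) (i : Fin d) : (k : ℕ) → (Fin k → Fin d) → Fock d
  | 0, _ => 0
  | k + 1, u => if i = u 0 then (C (k + 1) u : ℂ) • fockVec (Fin.tail u) else 0

/-- The annihilation operator weighted by `C`. -/
def annihilation {d : ℕ} (C : CCoeff d) (i : Fin d) : Fock d →ₗ[ℂ] Fock d :=
  fockLift (annihilationVec C i)

/-- The action of `x_i` on the Fock space. -/
def fockVar {d : ℕ} (T : TCoeff d) (C : CCoeff d) (i : Fin d) : Fock d →ₗ[ℂ] Fock d :=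
  creation i + preservation T i + annihilation C i

/-- The representation of the polynomials on the Fock space. -/
def fockRep {d : ℕ} (T : TCoeff d) (C : CCoeff d) : NCPoly d →ₐ[ℂ] Module.End ℂ (Fock d) :=
  FreeAlgebra.lift ℂ (fockVar T C)

theorem fockRep_var {d : ℕ} (T : TCoeff d) (C : CCoeff d) (i : Fin d) :
    fockRep T C (var i) = fockVar T C i :=
  FreeAlgebra.lift_ι_apply _ _

/-- The vacuum functional. -/
def fockState {d : ℕ} (T : TCoeff d) (C : CCoeff d) : NCPoly d →ₗ[ℂ] ℂ :=
  vacuumCoeff d ∘ₗ LinearMap.applyₗ (vacuum d) ∘ₗ (fockRep T C).toLinearMap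

theorem fockState_apply {d : ℕ} (T : TCoeff d) (C : CCoeff d) (p : NCPoly d) :
    fockState T C p = vacuumCoeff d (fockRep T C p (vacuum d)) := rfl

theorem fockVar_fockVec_zero {d : ℕ} (T : TCoeff d) (C : CCoeff d) (i : Fin d)
    (u : Fin 0 → Fin d) :
    fockVar T C i (fockVec u) = fockVec (Fin.cons i u : Fin 1 → Fin d) +
      ∑ w : Fin 0 → Fin d, T i 0 w u • fockVec w := by
  simp only [fockVar, creation, preservation, annihilation, LinearMap.add_apply,
    fockLift_fockVec, annihilationVec, add_zero]

theorem fockVar_fockVec_succ {d k : ℕ} (T : TCoeff d) (C : CCoeff d) (i : Fin d)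
    (u : Fin (k + 1) → Fin d) :
    fockVar T C i (fockVec u) = fockVec (Fin.cons i u : Fin (k + 2) → Fin d) +
      ∑ w : Fin (k + 1) → Fin d, T i (k + 1) w u • fockVec w +
      if i = u 0 then (C (k + 1) u : ℂ) • fockVec (Fin.tail u) else 0 := by
  simp only [fockVar, creation, preservation, annihilation, LinearMap.add_apply,
    fockLift_fockVec, annihilationVec]

/-- A solution of the recursion starting with `1` is represented by the basis of the Fock
space. -/
theorem fockRep_apply_vacuum {d : ℕ} {T : TCoeff d} {C : CCoeff d} {P : PolyFamily d}
    (h0 : ∀ u, P 0 u = 1) (hP : SatisfiesRecursion T C P) (k : ℕ) (u : Fin k → Fin d) :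
    fockRep T C (P k u) (vacuum d) = fockVec u := by
  induction k using Nat.strong_induction_on with
  | _ k ih =>
    match k with
    | 0 => rw [h0, map_one, fockVec_zero]; rfl
    | 1 =>
      have h := hP.zero (u 0) (Fin.tail u)
      rw [Fin.cons_self_tail, ← sub_eq_iff_eq_add] at h
      rw [← h, map_sub, map_mul, map_sum, fockRep_var, LinearMap.sub_apply, LinearMap.sum_apply]
      simp only [map_smul, LinearMap.smul_apply, Module.End.mul_apply,
        ih 0 Nat.zero_lt_one]
      rw [fockVar_fockVec_zero, Fin.cons_self_tail, add_sub_cancel_right]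
    | k + 2 =>
      have h := hP.succ (u 0) k (Fin.tail u)
      rw [Fin.cons_self_tail, add_assoc (P (k + 2) u), ← sub_eq_iff_eq_add] at h
      rw [← h, map_sub, map_add, map_mul, map_sum, fockRep_var, LinearMap.sub_apply,
        LinearMap.add_apply, LinearMap.sum_apply, apply_ite (fockRep T C),
        apply_ite (fun f : Module.End ℂ (Fock d) => f (vacuum d))]
      simp only [map_smul, LinearMap.smul_apply, Module.End.mul_apply, map_zero,
        LinearMap.zero_apply, ih (k + 1) (by omega), ih k (by omega)]
      rw [fockVar_fockVec_succ, Fin.cons_self_tail, add_assoc (fockVec u), add_sub_cancel_right]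

/-! ### The inner product on the Fock space -/

/-- The sesquilinear form with `⟨e_u, e_v⟩ = δ_{u,v} K_u`. -/
def fockForm {d : ℕ} (C : CCoeff d) (v w : Fock d) : ℂ :=
  Finsupp.linearCombination ℂ (fun x => starRingEnd ℂ (v x) * (kernelC C x.1 x.2 : ℂ)) w

variable {d : ℕ} (C : CCoeff d)

theorem fockForm_add_right (v w w' : Fock d) :
    fockForm C v (w + w') = fockForm C v w + fockForm C v w' := map_add _ _ _

theorem fockForm_smul_right (a : ℂ) (v w : Fock d) :
    fockForm C v (a • w) = a * fockForm C v w := map_smul _ _ _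

theorem fockForm_zero_right (v : Fock d) : fockForm C v 0 = 0 := map_zero _

theorem fockForm_sum_right {ι : Type*} (s : Finset ι) (v : Fock d) (w : ι → Fock d) :
    fockForm C v (∑ x ∈ s, w x) = ∑ x ∈ s, fockForm C v (w x) := map_sum _ _ _

theorem fockForm_conj (v w : Fock d) : starRingEnd ℂ (fockForm C v w) = fockForm C w v := by
  have h : ∀ v w : Fock d, fockForm C v w = ∑ x ∈ v.support ∪ w.support,
      w x * (starRingEnd ℂ (v x) * (kernelC C x.1 x.2 : ℂ)) := fun v w =>
    Finsupp.sum_of_support_subset _ Finset.subset_union_right _ (by simp)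
  rw [h, h, Finset.union_comm, map_sum]
  refine Finset.sum_congr rfl fun x _ => ?_
  simp only [map_mul, Complex.conj_conj, Complex.conj_ofReal]
  ring

theorem fockForm_fockVec {k l : ℕ} (u : Fin k → Fin d) (v : Fin l → Fin d) :
    fockForm C (fockVec u) (fockVec v) =
      if (⟨k, u⟩ : Σ n, Fin n → Fin d) = ⟨l, v⟩ then (kernelC C k u : ℂ) else 0 := by
  rw [fockForm, fockVec, fockVec, Finsupp.linearCombination_single, one_smul,
    Finsupp.single_apply]
  split_ifs with h
  · rw [← h]
    simp
  · simp

theorem fockForm_fockVec_of_ne {k l : ℕ} (u : Fin k → Fin d) (v : Fin l → Fin d) (h : k ≠ l) :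
    fockForm C (fockVec u) (fockVec v) = 0 := by
  rw [fockForm_fockVec, if_neg fun h' => h (congrArg Sigma.fst h')]

theorem fockForm_fockVec_same {k : ℕ} (u v : Fin k → Fin d) :
    fockForm C (fockVec u) (fockVec v) = if u = v then (kernelC C k u : ℂ) else 0 := by
  rw [fockForm_fockVec]
  simp

theorem fockForm_vacuum (w : Fock d) : fockForm C (vacuum d) w = vacuumCoeff d w := by
  induction w using Fock.induction with
  | zero => rw [fockForm_zero_right, map_zero]
  | add v w hv hw => rw [fockForm_add_right, hv, hw, map_add]
  | smul a v hv => rw [fockForm_smul_right, hv, map_smul, smul_eq_mul]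
  | fockVec k u =>
    cases k with
    | zero =>
      rw [fockVec_zero, vacuumCoeff_vacuum, vacuum, fockForm_fockVec_same, if_pos rfl]
      simp [kernelC]
    | succ k =>
      rw [vacuumCoeff_fockVec_succ, vacuum, fockForm_fockVec_of_ne _ _ _ (Nat.succ_ne_zero k).symm]

theorem kernelC_nonneg {C : CCoeff d} (hC : ∀ k (u : Fin (k + 1) → Fin d), 0 ≤ C (k + 1) u)
    (k : ℕ) (u : Fin k → Fin d) : 0 ≤ kernelC C k u := by
  induction k with
  | zero => exact zero_le_one
  | succ k ih => exact mul_nonneg (ih _) (hC k u)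

open scoped ComplexOrder in
theorem fockForm_self_nonneg {C : CCoeff d}
    (hC : ∀ k (u : Fin (k + 1) → Fin d), 0 ≤ C (k + 1) u) (v : Fock d) : 0 ≤ fockForm C v v := by
  rw [fockForm, Finsupp.linearCombination_apply, Finsupp.sum]
  refine Finset.sum_nonneg fun x _ => ?_
  rw [smul_eq_mul, ← mul_assoc, Complex.mul_conj]
  exact mul_nonneg (by exact_mod_cast Complex.normSq_nonneg _)
    (by exact_mod_cast kernelC_nonneg hC _ _)

/-- Formal adjointness with respect to the form may be checked on the basis. -/
theorem fockForm_adjoint_of_basis {A B : Fock d →ₗ[ℂ] Fock d}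
    (h : ∀ (k l : ℕ) (u : Fin k → Fin d) (v : Fin l → Fin d),
      fockForm C (fockVec u) (A (fockVec v)) = fockForm C (B (fockVec u)) (fockVec v))
    (v w : Fock d) : fockForm C v (A w) = fockForm C (B v) w := by
  induction w using Fock.induction with
  | zero => simp [fockForm_zero_right]
  | add w w' hw hw' => simp only [map_add, fockForm_add_right, hw, hw']
  | smul a w hw => simp only [map_smul, fockForm_smul_right, hw]
  | fockVec l u =>
    -- Conjugation swaps the arguments, so that linearity in the second argument also handles the
    -- induction on `v`.
    rw [← fockForm_conj, ← fockForm_conj C _ (B v), (starRingEnd ℂ).injective.eq_iff]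
    induction v using Fock.induction with
    | zero => simp [fockForm_zero_right]
    | add w w' hw hw' => simp only [map_add, fockForm_add_right, hw, hw']
    | smul a w hw => simp only [map_smul, fockForm_smul_right, hw]
    | fockVec k v =>
      rw [← (starRingEnd ℂ).injective.eq_iff, fockForm_conj, fockForm_conj, h]

/-- This is what dictates the form of `kernelC`: since K_{(i,v)} = K_v C_{(i,v)}, the weight gained
by creating a letter is the one the annihilation operator carries. -/
theorem fockForm_creation (i : Fin d) (v w : Fock d) :
    fockForm C v (creation i w) = fockForm C (annihilation C i v) w := by
  refine fockForm_adjoint_of_basis C (fun k l u v => ?_) v w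
  rw [creation, annihilation, fockLift_fockVec, fockLift_fockVec]
  cases k with
  | zero =>
    rw [annihilationVec, fockForm_fockVec_of_ne _ _ _ (Nat.succ_ne_zero l).symm, ← fockForm_conj,
      fockForm_zero_right, map_zero]
  | succ k =>
    rw [annihilationVec]
    by_cases hkl : k = l
    · subst hkl
      rw [fockForm_fockVec_same]
      by_cases hi : i = u 0
      · rw [if_pos hi, ← fockForm_conj, fockForm_smul_right, map_mul, fockForm_conj,
          fockForm_fockVec_same, Complex.conj_ofReal]
        have huv : u = Fin.cons i v ↔ Fin.tail u = v := by
          constructor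
          · rintro rfl; exact Fin.tail_cons _ _
          · rintro rfl; rw [hi, Fin.cons_self_tail]
        by_cases hv : Fin.tail u = v
        · rw [if_pos (huv.2 hv), if_pos hv, kernelC]
          push_cast
          ring
        · rw [if_neg (mt huv.1 hv), if_neg hv, mul_zero]
      · rw [if_neg hi, ← fockForm_conj C _ 0, fockForm_zero_right, map_zero, if_neg]
        rintro rfl
        exact hi rfl
    · rw [fockForm_fockVec_of_ne _ _ _ (by omega), ← fockForm_conj]
      split_ifs
      · rw [fockForm_smul_right, fockForm_fockVec_of_ne _ _ _ (Ne.symm hkl), mul_zero, map_zero]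
      · rw [fockForm_zero_right, map_zero]

theorem fockForm_annihilation (i : Fin d) (v w : Fock d) :
    fockForm C v (annihilation C i w) = fockForm C (creation i v) w := by
  rw [← fockForm_conj, ← fockForm_creation, fockForm_conj]

/-- The entrywise form is the symmetry of the preservation operator, tested on basis vectors. -/
theorem comm_iff {n : Type*} [Fintype n] [DecidableEq n] (A : Matrix n n ℂ) (K : n → ℝ) :
    Aᴴ * Matrix.diagonal (fun u => (K u : ℂ)) = Matrix.diagonal (fun u => (K u : ℂ)) * A ↔
      ∀ v u, starRingEnd ℂ (A v u) * K v = K u * A u v := by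
  rw [← Matrix.ext_iff, forall_comm]
  simp only [Matrix.mul_diagonal, Matrix.diagonal_mul, Matrix.conjTranspose_apply]
  rfl

theorem fockForm_preservation {T : TCoeff d} (i : Fin d)
    (h : ∀ k, (T i k)ᴴ * Matrix.diagonal (fun u => (kernelC C k u : ℂ)) =
      Matrix.diagonal (fun u => (kernelC C k u : ℂ)) * T i k) (v w : Fock d) :
    fockForm C v (preservation T i w) = fockForm C (preservation T i v) w := by
  refine fockForm_adjoint_of_basis C (fun k l u v => ?_) v w
  rw [preservation, fockLift_fockVec, fockLift_fockVec, ← fockForm_conj C _ (∑ w, _)]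
  simp only [fockForm_sum_right, fockForm_smul_right, map_sum, map_mul, fockForm_conj]
  by_cases hkl : k = l
  · subst hkl
    simp only [fockForm_fockVec_same, mul_ite, mul_zero, Finset.sum_ite_eq, Finset.sum_ite_eq',
      Finset.mem_univ, if_true]
    rw [(comm_iff _ _).1 (h k) v u, mul_comm]
  · rw [Finset.sum_eq_zero fun x _ => ?_, Finset.sum_eq_zero fun x _ => ?_]
    · rw [fockForm_fockVec_of_ne _ _ _ hkl, mul_zero]
    · rw [fockForm_fockVec_of_ne _ _ _ hkl, mul_zero]

/-! ### Vacuum functionals and the characterization of recursion coefficients -/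

variable {C} {T : TCoeff d}

theorem fockForm_fockRep
    (h : ∀ (i : Fin d) k, (T i k)ᴴ * Matrix.diagonal (fun u => (kernelC C k u : ℂ)) =
      Matrix.diagonal (fun u => (kernelC C k u : ℂ)) * T i k) (p : NCPoly d) (v w : Fock d) :
    fockForm C v (fockRep T C (adj p) w) = fockForm C (fockRep T C p v) w := by
  induction p using FreeAlgebra.induction generalizing v w with
  | grade0 a =>
    rw [Algebra.algebraMap_eq_smul_one, adj_smul, adj_one, map_smul, map_smul, map_one,
      LinearMap.smul_apply, LinearMap.smul_apply, ← fockForm_conj C w,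
      fockForm_smul_right, fockForm_smul_right, map_mul, fockForm_conj]
    rfl
  | grade1 i =>
    change fockForm C v (fockRep T C (adj (var i)) w) = fockForm C (fockRep T C (var i) v) w
    rw [adj_var, fockRep_var, fockVar]
    simp only [LinearMap.add_apply, fockForm_add_right]
    rw [← fockForm_conj C w]
    simp only [fockForm_add_right, map_add, fockForm_conj]
    rw [fockForm_creation, fockForm_annihilation, fockForm_preservation C i (h i)]
    ring
  | mul p q hp hq =>
    rw [adj_mul, map_mul, map_mul, Module.End.mul_apply, Module.End.mul_apply, hq, hp]
  | add p q hp hq =>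
    rw [adj_add, map_add, map_add, LinearMap.add_apply, LinearMap.add_apply, fockForm_add_right,
      hp, hq, ← fockForm_conj C w (_ + _), fockForm_add_right, map_add, fockForm_conj,
      fockForm_conj]

theorem fockState_adj_mul
    (h : ∀ (i : Fin d) k, (T i k)ᴴ * Matrix.diagonal (fun u => (kernelC C k u : ℂ)) =
      Matrix.diagonal (fun u => (kernelC C k u : ℂ)) * T i k) (p q : NCPoly d) :
    fockState T C (adj p * q) =
      fockForm C (fockRep T C p (vacuum d)) (fockRep T C q (vacuum d)) := by
  rw [fockState_apply, map_mul, Module.End.mul_apply, ← fockForm_vacuum C, fockForm_fockRep h]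

theorem isState_fockState (hC : ∀ k (u : Fin (k + 1) → Fin d), 0 ≤ C (k + 1) u)
    (h : ∀ (i : Fin d) k, (T i k)ᴴ * Matrix.diagonal (fun u => (kernelC C k u : ℂ)) =
      Matrix.diagonal (fun u => (kernelC C k u : ℂ)) * T i k) : IsState (fockState T C) where
  unital := by
    rw [fockState_apply, map_one]
    exact vacuumCoeff_vacuum
  hermitian X := by
    have h1 := fockState_adj_mul h X 1
    have h2 := fockState_adj_mul h 1 X
    rw [mul_one] at h1
    rw [adj_one, one_mul] at h2
    rw [h1, h2, fockForm_conj]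
  positive X := by
    rw [fockState_adj_mul h]
    exact fockForm_self_nonneg hC _

/-- The solution of the recursion. -/
def recursionFamily (T : TCoeff d) (C : CCoeff d) : PolyFamily d
  | 0, _ => 1
  | 1, u => var (u 0) - ∑ w : Fin 0 → Fin d, T (u 0) 0 w (Fin.tail u) • 1
  | k + 2, u => var (u 0) * recursionFamily T C (k + 1) (Fin.tail u) -
      (∑ w : Fin (k + 1) → Fin d,
          T (u 0) (k + 1) w (Fin.tail u) • recursionFamily T C (k + 1) w +
        if u 0 = Fin.tail u 0 then
          (C (k + 1) (Fin.tail u) : ℂ) • recursionFamily T C k (Fin.tail (Fin.tail u)) else 0)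

theorem satisfiesRecursion_recursionFamily (T : TCoeff d) (C : CCoeff d) :
    SatisfiesRecursion T C (recursionFamily T C) where
  zero i u := by simp [recursionFamily]
  succ i k u := by
    rw [recursionFamily]
    simp only [Fin.cons_zero, Fin.tail_cons]
    abel

theorem isMonicFamily_recursionFamily (T : TCoeff d) (C : CCoeff d) :
    IsMonicFamily (recursionFamily T C) := by
  intro k u
  change _ ∈ degreeLT d k
  induction k using Nat.strong_induction_on with
  | _ k ih =>
    have hmem : ∀ l (v : Fin l → Fin d), l < k → recursionFamily T C l v ∈ degreeLT d (l + 1) := by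
      intro l v hl
      rw [← sub_add_cancel (recursionFamily T C l v) (mono v)]
      exact add_mem (degreeLT_mono (Nat.le_succ l) (ih l hl v))
        (mono_mem_degreeLT (Nat.lt_succ_self l) v)
    match k with
    | 0 => simp [recursionFamily, mono_zero]
    | 1 =>
      have hu : mono u = var (u 0) := by simp [mono]
      rw [recursionFamily, hu, sub_sub_cancel_left]
      refine neg_mem (sum_mem fun w _ => Submodule.smul_mem _ _ ?_)
      rw [← mono_zero w]
      exact mono_mem_degreeLT Nat.zero_lt_one _
    | k + 2 =>
      have hu : mono u = var (u 0) * mono (Fin.tail u) := by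
        rw [var_mul_mono, Fin.cons_self_tail]
      rw [recursionFamily, hu, sub_right_comm, ← mul_sub]
      refine sub_mem (var_mul_mem_degreeLT _ (ih (k + 1) (by omega) _)) (add_mem ?_ ?_)
      · exact sum_mem fun w _ => Submodule.smul_mem _ _ (hmem _ _ (by omega))
      · split_ifs
        · exact Submodule.smul_mem _ _ (degreeLT_mono (by omega) (hmem k _ (by omega)))
        · exact zero_mem _

theorem isMOPS_fockState
    (h : ∀ (i : Fin d) k, (T i k)ᴴ * Matrix.diagonal (fun u => (kernelC C k u : ℂ)) =
      Matrix.diagonal (fun u => (kernelC C k u : ℂ)) * T i k) :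
    IsMOPS (fockState T C) (recursionFamily T C) where
  monic := isMonicFamily_recursionFamily T C
  orthogonal k l u v huv := by
    have hr := fockRep_apply_vacuum (fun u => rfl) (satisfiesRecursion_recursionFamily T C)
    rw [fockState_adj_mul h, hr, hr, fockForm_fockVec, if_neg huv]

/-- A functional has recursion coefficients `T`, `C` exactly if it is the vacuum functional of the
associated representation. -/
theorem isRecursionCoeff_iff {φ : NCPoly d →ₗ[ℂ] ℂ} (hφ : φ 1 = 1) :
    IsRecursionCoeff φ T C ↔ (∀ k (u : Fin (k + 1) → Fin d), 0 ≤ C (k + 1) u) ∧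
      (∀ (i : Fin d) k, (T i k)ᴴ * Matrix.diagonal (fun u => (kernelC C k u : ℂ)) =
        Matrix.diagonal (fun u => (kernelC C k u : ℂ)) * T i k) ∧ φ = fockState T C := by
  constructor
  · rintro ⟨hC, hT, P, hP, hrec⟩
    refine ⟨hC, hT, LinearMap.ext fun p => ?_⟩
    -- The family spans, and both functionals take the value 1 at P_∅ and 0 at every other P_u: φ
    -- because P_u is orthogonal to P_∅ = 1, the vacuum functional because P_u Ω = e_u.
    induction p using hP.monic.induction with
    | zero => simp
    | add p q hp hq => rw [map_add, map_add, hp, hq]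
    | smul a p hp => rw [map_smul, map_smul, hp]
    | family k u =>
      rw [fockState_apply, fockRep_apply_vacuum hP.monic.zero_eq_one hrec]
      cases k with
      | zero => rw [hP.monic.zero_eq_one, hφ, fockVec_zero, vacuumCoeff_vacuum]
      | succ k =>
        rw [vacuumCoeff_fockVec_succ]
        have h := hP.orthogonal 0 (k + 1) Fin.elim0 u
          fun h => absurd (congrArg Sigma.fst h) (Nat.succ_ne_zero k).symm
        rwa [hP.monic.zero_eq_one, adj_one, one_mul] at h
  · rintro ⟨hC, hT, rfl⟩
    exact ⟨hC, hT, _, isMOPS_fockState hT, satisfiesRecursion_recursionFamily T C⟩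

end

noncomputable section

/-! ### Sums over compositions -/

/-- The product of the values of `f` on consecutive blocks of a word, of the given lengths. -/
def blockProd {d : ℕ} (f : List (Fin d) → ℂ) : List ℕ → List (Fin d) → ℂ
  | [], _ => 1
  | b :: bs, w => f (w.take b) * blockProd f bs (w.drop b)

/-- Passing to lists replaces block embeddings, whose types depend on the composition, by a product
defined by recursion on the first block. -/
theorem prod_take_drop_eq_blockProd {d : ℕ} (f : List (Fin d) → ℂ) (bs : List ℕ)
    (w : List (Fin d)) :
    ∏ j : Fin bs.length, f ((w.drop (bs.take j).sum).take bs[j]) = blockProd f bs w := by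
  induction bs generalizing w with
  | nil => rfl
  | cons b bs ih =>
    change ∏ j : Fin (bs.length + 1), _ = _
    rw [Fin.prod_univ_succ, blockProd, ← ih]
    simp [List.drop_drop]

theorem ofFn_comp_embedding {d n : ℕ} (c : Composition n) (u : Fin n → Fin d)
    (j : Fin c.length) :
    List.ofFn (u ∘ c.embedding j) =
      ((List.ofFn u).drop (c.blocks.take j).sum).take (c.blocksFun j) := by
  have hle : c.sizeUpTo j + c.blocksFun j ≤ n := by
    rw [← c.sizeUpTo_succ']
    exact c.sizeUpTo_le _
  have hs : (c.blocks.take j).sum = c.sizeUpTo j := rfl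
  rw [hs]
  apply List.ext_getElem
  · simp
    omega
  · intro k h1 h2
    simp only [List.getElem_ofFn, List.getElem_take, List.getElem_drop, Function.comp_apply]
    congr 1

theorem prod_embedding_eq_blockProd {d n : ℕ} (f : List (Fin d) → ℂ) (c : Composition n)
    (u : Fin n → Fin d) :
    ∏ j : Fin c.length, f (List.ofFn (u ∘ c.embedding j)) =
      blockProd f c.blocks (List.ofFn u) := by
  rw [← prod_take_drop_eq_blockProd]
  exact Finset.prod_congr rfl fun j _ => by rw [ofFn_comp_embedding]; rfl

/-- Prepend a block of size `b + 1`. -/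
def consBlock {n : ℕ} (b : Fin (n + 1)) (c : Composition (n - b)) : Composition (n + 1) where
  blocks := (b + 1) :: c.blocks
  blocks_pos := by
    intro i hi
    rcases List.mem_cons.1 hi with rfl | hi
    · omega
    · exact c.blocks_pos hi
  blocks_sum := by
    rw [List.sum_cons, c.blocks_sum]
    omega

/-- A composition of `n + 1` amounts to its first block and a composition of the remainder; block
sizes are shifted by one because blocks are non-empty. -/
theorem consBlock_bijective (n : ℕ) : Function.Bijective
    fun x : (Σ b : Fin (n + 1), Composition (n - b)) => consBlock x.1 x.2 := by
  constructor
  · rintro ⟨b, c⟩ ⟨b', c'⟩ h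
    have h' := congrArg Composition.blocks h
    simp only [consBlock, List.cons.injEq, Nat.add_right_cancel_iff] at h'
    obtain rfl := Fin.ext h'.1
    rw [Composition.ext h'.2]
  · intro c
    obtain ⟨bs, hpos, hsum⟩ := c
    cases bs with
    | nil => simp at hsum
    | cons b bs =>
      have hb := hpos (List.mem_cons_self ..)
      rw [List.sum_cons] at hsum
      refine ⟨⟨⟨b - 1, by omega⟩, ⟨bs, fun h => hpos (List.mem_cons_of_mem _ h), ?_⟩⟩, ?_⟩
      · simp only
        omega
      · ext1
        simp only [consBlock]
        congr 1
        omega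

/-- A solution `M` of the recursion over the first block is the sum over all compositions. -/
theorem eq_sum_blockProd {d : ℕ} (f M : List (Fin d) → ℂ) (hnil : M [] = 1)
    (hM : ∀ a w, M (a :: w) = ∑ b ∈ Finset.range (w.length + 1),
      f ((a :: w).take (b + 1)) * M ((a :: w).drop (b + 1)))
    (n : ℕ) (w : List (Fin d)) (hw : w.length = n) :
    M w = ∑ c : Composition n, blockProd f c.blocks w := by
  induction n using Nat.strong_induction_on generalizing w with
  | _ n ih =>
    cases w with
    | nil =>
      obtain rfl : 0 = n := hw
      have h : ∀ c : Composition 0, blockProd f c.blocks [] = 1 := by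
        intro c
        have hc : c.blocks = [] := List.length_eq_zero_iff.1 (Nat.le_zero.1 c.length_le)
        rw [hc]
        rfl
      simp [h, hnil, composition_card]
    | cons a w =>
      obtain rfl : w.length + 1 = n := hw
      rw [hM, ← (consBlock_bijective w.length).sum_comp
        (fun c => blockProd f c.blocks (a :: w)), Fintype.sum_sigma, Finset.sum_range]
      refine Finset.sum_congr rfl fun b _ => ?_
      rw [ih (w.length - b) (by omega) _ (by simp), Finset.mul_sum]
      rfl

/-- The Boolean cumulants are determined by the moment-cumulant formula. -/
theorem boolCumulant_eq_of_moments {d : ℕ} (φ : NCPoly d →ₗ[ℂ] ℂ)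
    (g : (n : ℕ) → (Fin n → Fin d) → ℂ) (hg : ∀ u, g 0 u = 0)
    (h : ∀ (n : ℕ) (u : Fin n → Fin d), φ (mono u) = ∑ c : Composition n,
      ∏ j : Fin c.length, g (c.blocksFun j) (u ∘ c.embedding j))
    (n : ℕ) (u : Fin n → Fin d) : boolCumulant φ n u = g n u := by
  induction n using Nat.strong_induction_on with
  | _ n ih =>
    cases n with
    | zero => rw [hg, boolCumulant]
    | succ n =>
      rw [boolCumulant, h, sum_composition_split g n.succ_pos u, sub_eq_iff_eq_add]
      congr 1
      refine Finset.sum_congr rfl fun c _ => Finset.prod_congr rfl fun j _ => ?_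
      exact (ih _ ((Composition.ne_single_iff n.succ_pos).1 c.2 j) _).symm

end

noncomputable section

/-! ### Boolean cumulants of vacuum functionals -/

variable {d : ℕ}

/-- `x_i` followed by the projection onto the complement of the vacuum vector. -/
def cutVar (T : TCoeff d) (C : CCoeff d) (i : Fin d) (v : Fock d) : Fock d :=
  fockVar T C i v - vacuumCoeff d (fockVar T C i v) • vacuum d

/-- The action of a word of variables on the vacuum. -/
def wordVec (T : TCoeff d) (C : CCoeff d) (w : List (Fin d)) : Fock d :=
  w.foldr (fun i v => fockVar T C i v) (vacuum d)

/-- The action of a word of cut variables on the vacuum. -/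
def cutVec (T : TCoeff d) (C : CCoeff d) (w : List (Fin d)) : Fock d :=
  w.foldr (cutVar T C) (vacuum d)

/-- The Boolean cumulants of the vacuum functional. -/
def fockCumulant (T : TCoeff d) (C : CCoeff d) : List (Fin d) → ℂ
  | [] => 0
  | i :: w => vacuumCoeff d (fockVar T C i (cutVec T C w))

variable (T : TCoeff d) (C : CCoeff d)

theorem fockRep_mono_vacuum {n : ℕ} (u : Fin n → Fin d) :
    fockRep T C (mono u) (vacuum d) = wordVec T C (List.ofFn u) := by
  have h : List.ofFn (fun j => var (u j)) = (List.ofFn u).map var := by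
    rw [List.map_ofFn]
    rfl
  rw [mono, h]
  generalize List.ofFn u = w
  induction w with
  | nil => rw [List.map_nil, List.prod_nil, map_one]; rfl
  | cons a w ih =>
    rw [List.map_cons, List.prod_cons, map_mul, Module.End.mul_apply, ih, fockRep_var]
    rfl

/-- Letters act from the right, and after each letter the identity is split into Q plus the vacuum
projection. The index `b` marks the final visit to the vacuum: `w.drop b` leads there, and the
remaining `b` letters never return. -/
theorem wordVec_eq_sum (w : List (Fin d)) :
    wordVec T C w = ∑ b ∈ Finset.range (w.length + 1),
      vacuumCoeff d (wordVec T C (w.drop b)) • cutVec T C (w.take b) := by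
  induction w with
  | nil => simp [wordVec, cutVec, vacuumCoeff_vacuum]
  | cons a w ih =>
    have h1 : wordVec T C (a :: w) = fockVar T C a (wordVec T C w) := rfl
    have h2 : ∀ v, cutVec T C (a :: v) = cutVar T C a (cutVec T C v) := fun _ => rfl
    rw [List.length_cons, Finset.sum_range_succ']
    simp only [List.drop_succ_cons, List.take_succ_cons, List.drop_zero, List.take_zero, h2,
      cutVar, smul_sub, Finset.sum_sub_distrib]
    -- The vacuum terms subtracted by the cuts add up, by linearity and the induction hypothesis, to
    -- the vacuum part of the whole word; the `b = 0` term restores it.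
    simp only [← map_smul, smul_smul, ← smul_eq_mul, ← Finset.sum_smul]
    rw [← map_sum, ← map_sum, ← map_sum, ← ih, ← h1]
    simp [cutVec]

theorem fockState_mono {n : ℕ} (u : Fin n → Fin d) :
    fockState T C (mono u) = ∑ c : Composition n,
      ∏ j : Fin c.length, fockCumulant T C (List.ofFn (u ∘ c.embedding j)) := by
  simp only [prod_embedding_eq_blockProd]
  rw [fockState_apply, fockRep_mono_vacuum]
  refine eq_sum_blockProd (fockCumulant T C) (fun w => vacuumCoeff d (wordVec T C w))
    vacuumCoeff_vacuum (fun a w => ?_) n _ (List.length_ofFn)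
  -- Applying the leftmost variable to the decomposition of `wordVec` and taking vacuum coefficients
  -- gives the recursion over the first block.
  have h1 : wordVec T C (a :: w) = fockVar T C a (wordVec T C w) := rfl
  rw [h1, wordVec_eq_sum, map_sum, map_sum]
  refine Finset.sum_congr rfl fun b _ => ?_
  rw [map_smul, map_smul, smul_eq_mul, mul_comm, List.take_succ_cons, fockCumulant,
    List.drop_succ_cons]

theorem boolCumulant_fockState (n : ℕ) (u : Fin n → Fin d) :
    boolCumulant (fockState T C) n u = fockCumulant T C (List.ofFn u) :=
  boolCumulant_eq_of_moments _ (fun _ u => fockCumulant T C (List.ofFn u))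
    (fun u => by rw [List.ofFn_zero, fockCumulant]) (fun _ u => fockState_mono T C u) n u

/-! ### Rescaling the coefficients -/

variable (t : ℝ)

/-- Only two transitions end in the vacuum: from the vacuum itself through T^{(0)}, and from
one-letter vectors through C^{(1)}. These are the rescaled ones. -/
theorem fockVar_scale (i : Fin d) (v : Fock d) :
    fockVar (scaleT t T) (scaleC t C) i v =
      fockVar T C i v + ((t - 1) * vacuumCoeff d (fockVar T C i v)) • vacuum d := by
  induction v using Fock.induction with
  | zero => simp
  | add v w hv hw =>
    rw [map_add, map_add, hv, hw, map_add, mul_add, add_smul]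
    abel
  | smul a v hv =>
    rw [map_smul, map_smul, hv, map_smul, smul_add, smul_smul, smul_eq_mul, mul_left_comm]
  | fockVec k u =>
    match k with
    | 0 =>
      rw [fockVar_fockVec_zero, fockVar_fockVec_zero, map_add, vacuumCoeff_fockVec_succ]
      simp only [scaleT, if_true, Matrix.smul_apply, fockVec_zero, ← Finset.sum_smul, map_smul,
        vacuumCoeff_vacuum, smul_eq_mul, ← Finset.mul_sum, mul_one, zero_add, add_assoc, ← add_smul]
      congr 2
      ring
    | 1 =>
      rw [fockVar_fockVec_succ, fockVar_fockVec_succ, map_add, map_add, vacuumCoeff_fockVec_succ]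
      simp only [scaleT, scaleC, one_ne_zero, if_false, zero_add, if_true, fockVec_zero, map_sum,
        map_smul, vacuumCoeff_fockVec_succ, Finset.sum_const_zero, apply_ite (vacuumCoeff d), map_zero,
        vacuumCoeff_vacuum, smul_eq_mul, mul_one, mul_ite, mul_zero, add_assoc]
      congr 2
      split_ifs
      · rw [← add_smul]
        push_cast
        congr 1
        ring
      · simp
    | k + 2 =>
      rw [fockVar_fockVec_succ, fockVar_fockVec_succ, map_add, map_add, vacuumCoeff_fockVec_succ]
      simp [scaleT, scaleC, vacuumCoeff_fockVec_succ, apply_ite (vacuumCoeff d)]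

theorem vacuumCoeff_fockVar_scale (i : Fin d) (v : Fock d) :
    vacuumCoeff d (fockVar (scaleT t T) (scaleC t C) i v) =
      t * vacuumCoeff d (fockVar T C i v) := by
  rw [fockVar_scale, map_add, map_smul, vacuumCoeff_vacuum, smul_eq_mul]
  ring

theorem cutVar_scale : cutVar (scaleT t T) (scaleC t C) = cutVar T C := by
  funext i v
  rw [cutVar, vacuumCoeff_fockVar_scale, fockVar_scale, cutVar]
  module

theorem fockCumulant_scale (w : List (Fin d)) :
    fockCumulant (scaleT t T) (scaleC t C) w = t * fockCumulant T C w := by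
  cases w with
  | nil => simp [fockCumulant]
  | cons i w =>
    rw [fockCumulant, fockCumulant, vacuumCoeff_fockVar_scale, cutVec, cutVec, cutVar_scale]

theorem fockState_one : fockState T C 1 = 1 := by
  rw [fockState_apply, map_one]
  exact vacuumCoeff_vacuum

theorem fockState_scale :
    fockState (scaleT t T) (scaleC t C) = boolConvPow (fockState T C) t := by
  refine eq_boolConvPow _ _ t (fockState_one _ _) fun n u => ?_
  rw [boolCumulant_fockState, boolCumulant_fockState, fockCumulant_scale]

/-- A non-empty word has exactly one suffix of length one, so the factor `t` enters once. -/
theorem kernelC_scaleC (k : ℕ) (u : Fin (k + 1) → Fin d) :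
    kernelC (scaleC t C) (k + 1) u = t * kernelC C (k + 1) u := by
  induction k with
  | zero => simp [kernelC, scaleC]
  | succ k ih =>
    rw [kernelC, ih, kernelC.eq_2 C (k + 1)]
    simp [scaleC, mul_assoc]

variable {T C t}

theorem isRecursionCoeff_scale {φ : NCPoly d →ₗ[ℂ] ℂ} (hφ : φ 1 = 1) (ht : 0 ≤ t)
    (h : IsRecursionCoeff φ T C) :
    IsRecursionCoeff (boolConvPow φ t) (scaleT t T) (scaleC t C) := by
  obtain ⟨hC, hT, rfl⟩ := (isRecursionCoeff_iff hφ).1 h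
  refine (isRecursionCoeff_iff (boolConvPow_one _ t)).2 ⟨fun k u => ?_, fun i k => ?_,
    (fockState_scale T C t).symm⟩
  · rw [scaleC]
    split_ifs
    · exact mul_nonneg ht (hC k u)
    · exact hC k u
  -- At level 0 the kernel is 1 and T^{(0)} gains a real factor; at higher levels the kernel gains
  -- the same factor `t` on both sides.
  · rw [comm_iff]
    have h' := (comm_iff _ _).1 (hT i k)
    intro v u
    cases k with
    | zero =>
      have := h' v u
      simp only [kernelC, Complex.ofReal_one, mul_one, one_mul] at this
      simp [scaleT, kernelC, this]
    | succ k =>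
      rw [kernelC_scaleC, kernelC_scaleC]
      have := h' v u
      simp only [scaleT, Nat.succ_ne_zero, if_false]
      push_cast
      rw [mul_left_comm, this, mul_assoc]

theorem scaleT_inv (ht : t ≠ 0) : scaleT t⁻¹ (scaleT t T) = T := by
  funext i k
  by_cases hk : k = 0
  · have ht' : (t : ℂ) ≠ 0 := by exact_mod_cast ht
    simp only [scaleT, hk, if_true, Complex.ofReal_inv]
    rw [inv_smul_smul₀ ht']
  · simp [scaleT, hk]

theorem scaleC_inv (ht : t ≠ 0) : scaleC t⁻¹ (scaleC t C) = C := by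
  funext k u
  by_cases hk : k = 1
  · simp [scaleC, hk, ht]
  · simp [scaleC, hk]

theorem boolConvPow_inv {φ : NCPoly d →ₗ[ℂ] ℂ} (hφ : φ 1 = 1) (ht : t ≠ 0) :
    boolConvPow (boolConvPow φ t) t⁻¹ = φ := by
  refine (eq_boolConvPow _ _ _ hφ fun n u => ?_).symm
  rw [boolCumulant_boolConvPow, Complex.ofReal_inv, inv_mul_cancel_left₀]
  exact_mod_cast ht

/-- The forward direction, applied to φ^{⊎ t} with exponent t⁻¹, undoes the rescaling and also
recovers the non-negativity of `C`. -/
theorem isRecursionCoeff_of_scale {φ : NCPoly d →ₗ[ℂ] ℂ} (hφ : φ 1 = 1) (ht : 0 < t)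
    (h : IsRecursionCoeff (boolConvPow φ t) (scaleT t T) (scaleC t C)) :
    IsRecursionCoeff φ T C := by
  have := isRecursionCoeff_scale (boolConvPow_one φ t) (inv_nonneg.2 ht.le) h
  rwa [boolConvPow_inv hφ ht.ne', scaleT_inv ht.ne', scaleC_inv ht.ne'] at this

end

noncomputable section

/-! ### Existence of recursion coefficients -/

variable {d : ℕ} {φ : NCPoly d →ₗ[ℂ] ℂ} {P : PolyFamily d}

theorem IsState.conj_adj_mul (hφ : IsState φ) (p q : NCPoly d) :
    starRingEnd ℂ (φ (adj p * q)) = φ (adj q * p) := by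
  rw [← hφ.hermitian, adj_mul, adj_adj]

/-- The left ideal of polynomials orthogonal to all polynomials. -/
def nullIdeal (φ : NCPoly d →ₗ[ℂ] ℂ) : Submodule ℂ (NCPoly d) where
  carrier := {p | ∀ q, φ (q * p) = 0}
  add_mem' hp hp' q := by rw [mul_add, map_add, hp, hp', add_zero]
  zero_mem' q := by rw [mul_zero, map_zero]
  smul_mem' a p hp q := by rw [mul_smul_comm, map_smul, hp, smul_zero]

theorem mul_mem_nullIdeal {p : NCPoly d} (hp : p ∈ nullIdeal φ) (q : NCPoly d) :
    q * p ∈ nullIdeal φ := fun r => by rw [← mul_assoc]; exact hp _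

namespace IsMOPS

theorem mem_nullIdeal (hP : IsMOPS φ P) {p : NCPoly d}
    (h : ∀ k u, φ (adj (P k u) * p) = 0) : p ∈ nullIdeal φ := by
  intro q
  rw [← adj_adj q]
  induction adj q using hP.monic.induction with
  | zero => simp [← adjₗ_apply]
  | add q q' hq hq' => rw [adj_add, add_mul, map_add, hq, hq', add_zero]
  | smul a q hq => rw [adj_smul, smul_mul_assoc, map_smul, hq, smul_zero]
  | family k u => exact h k u

theorem orthogonal_of_ne (hP : IsMOPS φ P) {k l : ℕ} (u : Fin k → Fin d) (v : Fin l → Fin d)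
    (h : k ≠ l) : φ (adj (P k u) * P l v) = 0 :=
  hP.orthogonal k l u v fun h' => h (congrArg Sigma.fst h')

theorem orthogonal_same (hP : IsMOPS φ P) {k : ℕ} (u v : Fin k → Fin d) :
    φ (adj (P k u) * P k v) = if u = v then φ (adj (P k u) * P k u) else 0 := by
  split_ifs with h
  · rw [h]
  · exact hP.orthogonal k k u v (by simpa using h)

/-- Orthogonality to the other members of the family is given, so vanishing norm suffices without
Cauchy–Schwarz. -/
theorem mem_nullIdeal_of_norm (hP : IsMOPS φ P) {k : ℕ} {u : Fin k → Fin d}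
    (h : φ (adj (P k u) * P k u) = 0) : P k u ∈ nullIdeal φ := by
  refine hP.mem_nullIdeal fun l v => ?_
  by_cases hlk : l = k
  · subst hlk
    rw [hP.orthogonal_same]
    split_ifs with hv
    · rwa [hv]
    · rfl
  · exact hP.orthogonal_of_ne _ _ hlk

theorem orthogonal_degreeLT (hP : IsMOPS φ P) {k : ℕ} (u : Fin k → Fin d) {p : NCPoly d}
    (hp : p ∈ degreeLT d k) : φ (adj (P k u) * p) = 0 := by
  have h := hP.monic.degreeLT_le_span k hp
  clear hp
  induction h using Submodule.span_induction with
  | mem p hp =>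
    obtain ⟨l, v, hl, rfl⟩ := hp
    exact hP.orthogonal_of_ne _ _ hl.ne'
  | zero => simp
  | add p q _ _ hp hq => rw [mul_add, map_add, hp, hq, add_zero]
  | smul a p _ hp => rw [mul_smul_comm, map_smul, hp, smul_zero]

end IsMOPS

/-- The squared norms of the orthogonal polynomials. -/
def sqNorm (φ : NCPoly d →ₗ[ℂ] ℂ) (P : PolyFamily d) (k : ℕ) (u : Fin k → Fin d) : ℝ :=
  (φ (adj (P k u) * P k u)).re

/-- The matrices of the orthogonal polynomials. -/
def mopsT (φ : NCPoly d →ₗ[ℂ] ℂ) (P : PolyFamily d) : TCoeff d := fun i k w u =>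
  φ (adj (P k w) * (var i * P k u)) / sqNorm φ P k w

/-- The quotients of consecutive squared norms. -/
def mopsC (φ : NCPoly d →ₗ[ℂ] ℂ) (P : PolyFamily d) : CCoeff d
  | 0, _ => 0
  | k + 1, u => sqNorm φ P (k + 1) u / sqNorm φ P k (Fin.tail u)

theorem sqNorm_nonneg (hφ : IsState φ) (k : ℕ) (u : Fin k → Fin d) : 0 ≤ sqNorm φ P k u :=
  (Complex.le_def.1 (hφ.positive (P k u))).1

theorem coe_sqNorm (hφ : IsState φ) (k : ℕ) (u : Fin k → Fin d) :
    (sqNorm φ P k u : ℂ) = φ (adj (P k u) * P k u) :=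
  Complex.conj_eq_iff_re.1 (hφ.conj_adj_mul _ _)

theorem adj_mul_var_mul (i : Fin d) (p q : NCPoly d) :
    adj p * (var i * q) = adj (var i * p) * q := by
  rw [adj_mul, adj_var, mul_assoc]

namespace IsMOPS

theorem mem_nullIdeal_of_sqNorm (hP : IsMOPS φ P) (hφ : IsState φ) {k : ℕ} {u : Fin k → Fin d}
    (h : sqNorm φ P k u = 0) : P k u ∈ nullIdeal φ :=
  hP.mem_nullIdeal_of_norm (by rw [← coe_sqNorm hφ, h, Complex.ofReal_zero])

/-- The difference x_i P_u − P_{(i,u)} has degree at most `k`, hence is orthogonal to P_v with `k <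
l`. -/
theorem adj_mul_var_mul_of_lt (hP : IsMOPS φ P) (i : Fin d) {k l : ℕ} (u : Fin k → Fin d)
    (v : Fin l → Fin d) (h : k < l) :
    φ (adj (P l v) * (var i * P k u)) = φ (adj (P l v) * P (k + 1) (Fin.cons i u)) := by
  rw [← sub_eq_zero, ← map_sub, ← mul_sub]
  exact hP.orthogonal_degreeLT v (degreeLT_mono h (hP.monic.var_mul_sub_mem i u))

theorem adj_mul_var_mul_of_gt (hP : IsMOPS φ P) (hφ : IsState φ) (i : Fin d) {k l : ℕ}
    (u : Fin k → Fin d) (v : Fin l → Fin d) (h : l < k) :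
    φ (adj (P l v) * (var i * P k u)) = φ (adj (P (l + 1) (Fin.cons i v)) * P k u) := by
  rw [BooleanPower.adj_mul_var_mul, ← hφ.conj_adj_mul, hP.adj_mul_var_mul_of_lt i v u h,
    hφ.conj_adj_mul]

/-- Null polynomials form a left ideal, so x_i P_u is null with P_u, and its pairing with P_{(i,u)}
is the squared norm of the latter. -/
theorem sqNorm_cons_eq_zero (hP : IsMOPS φ P) (hφ : IsState φ) (i : Fin d) {k : ℕ}
    (u : Fin k → Fin d) (h : sqNorm φ P k u = 0) :
    sqNorm φ P (k + 1) (Fin.cons i u) = 0 := by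
  rw [sqNorm, ← hP.adj_mul_var_mul_of_lt i u _ (Nat.lt_succ_self k),
    mul_mem_nullIdeal (hP.mem_nullIdeal_of_sqNorm hφ h) (var i), Complex.zero_re]

theorem sqNorm_tail_mul_mopsC (hP : IsMOPS φ P) (hφ : IsState φ) {k : ℕ}
    (u : Fin (k + 1) → Fin d) :
    sqNorm φ P k (Fin.tail u) * mopsC φ P (k + 1) u = sqNorm φ P (k + 1) u := by
  rw [mopsC]
  -- Division by a zero norm gives 0, which is harmless: the numerator then vanishes too.
  refine mul_div_cancel_of_imp' fun h => ?_
  have := hP.sqNorm_cons_eq_zero hφ (u 0) _ h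
  rwa [Fin.cons_self_tail] at this

/-- The product of consecutive quotients telescopes down to the norm of P_∅ = 1. -/
theorem kernelC_mopsC (hP : IsMOPS φ P) (hφ : IsState φ) (k : ℕ) (u : Fin k → Fin d) :
    kernelC (mopsC φ P) k u = sqNorm φ P k u := by
  induction k with
  | zero => simp [kernelC, sqNorm, hP.monic.zero_eq_one, adj_one, hφ.unital]
  | succ k ih => rw [kernelC, ih, hP.sqNorm_tail_mul_mopsC hφ]

theorem sqNorm_mul_mopsT (hP : IsMOPS φ P) (hφ : IsState φ) (i : Fin d) {k : ℕ}
    (w u : Fin k → Fin d) :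
    (sqNorm φ P k w : ℂ) * mopsT φ P i k w u = φ (adj (P k w) * (var i * P k u)) := by
  rw [mopsT]
  refine mul_div_cancel_of_imp' fun h => ?_
  rw [BooleanPower.adj_mul_var_mul, ← hφ.conj_adj_mul,
    mul_mem_nullIdeal (hP.mem_nullIdeal_of_sqNorm hφ (Complex.ofReal_eq_zero.1 h)) (var i),
    map_zero]

theorem comm_mopsT (hP : IsMOPS φ P) (hφ : IsState φ) (i : Fin d) (k : ℕ) :
    (mopsT φ P i k)ᴴ * Matrix.diagonal (fun u => (kernelC (mopsC φ P) k u : ℂ)) =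
      Matrix.diagonal (fun u => (kernelC (mopsC φ P) k u : ℂ)) * mopsT φ P i k := by
  rw [comm_iff]
  intro v u
  rw [hP.kernelC_mopsC hφ, hP.kernelC_mopsC hφ, hP.sqNorm_mul_mopsT hφ, mul_comm,
    ← Complex.conj_ofReal, ← map_mul, hP.sqNorm_mul_mopsT hφ, hφ.conj_adj_mul,
    BooleanPower.adj_mul_var_mul]

/-- The recursion holds modulo polynomials of norm zero. -/
theorem var_mul_sub_mem_nullIdeal (hP : IsMOPS φ P) (hφ : IsState φ) (i : Fin d) (v : Fock d) :
    var i * fockLift P v - fockLift P (fockVar (mopsT φ P) (mopsC φ P) i v) ∈ nullIdeal φ := by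
  induction v using Fock.induction with
  | zero => simp
  | add v w hv hw =>
    have := add_mem hv hw
    rwa [sub_add_sub_comm, ← mul_add, ← map_add, ← map_add, ← map_add] at this
  | smul a v hv =>
    have := (nullIdeal φ).smul_mem a hv
    rwa [smul_sub, ← mul_smul_comm, ← map_smul, ← map_smul, ← map_smul] at this
  | fockVec k u =>
    refine hP.mem_nullIdeal fun l v => ?_
    -- Annihilation, preservation and creation reproduce the pairing of P_v with x_i P_u for `l <
    -- k`, `l = k` and `l > k` respectively, and contribute 0 otherwise.
    have hann : φ (adj (P l v) * fockLift P (annihilation (mopsC φ P) i (fockVec u))) =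
        if l < k then φ (adj (P l v) * (var i * P k u)) else 0 := by
      rw [annihilation, fockLift_fockVec]
      cases k with
      | zero => simp [annihilationVec]
      | succ k =>
        by_cases hlk : l = k
        · subst hlk
          rw [annihilationVec, if_pos (Nat.lt_succ_self l),
            hP.adj_mul_var_mul_of_gt hφ i u v (Nat.lt_succ_self l), hP.orthogonal_same]
          split_ifs with hi hu hu
          · rw [map_smul, fockLift_fockVec, mul_smul_comm, map_smul, smul_eq_mul,
              hP.orthogonal_same, ← hu, Fin.tail_cons, if_pos rfl, ← coe_sqNorm hφ,
              ← coe_sqNorm hφ, ← hP.sqNorm_tail_mul_mopsC hφ, Fin.tail_cons, mul_comm]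
            push_cast
            rfl
          · rw [map_smul, fockLift_fockVec, mul_smul_comm, map_smul, hP.orthogonal_same, if_neg,
              smul_zero]
            rintro rfl
            exact hu (by rw [hi, Fin.cons_self_tail])
          · exact absurd (by rw [← hu, Fin.cons_zero]) hi
          · simp
        -- For `l < k`, moving x_i to the left factor gives P_{(i,v)} of length `l + 1 < k + 1`, so
        -- the pairing vanishes.
        · have h1 : (if l < k + 1 then φ (adj (P l v) * (var i * P (k + 1) u)) else 0) = 0 := by
            split_ifs with h
            · rw [hP.adj_mul_var_mul_of_gt hφ i u v h, hP.orthogonal_of_ne _ _ (by omega)]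
            · rfl
          rw [h1, annihilationVec]
          split_ifs
          · rw [map_smul, fockLift_fockVec, mul_smul_comm, map_smul,
              hP.orthogonal_of_ne _ _ hlk, smul_zero]
          · simp
    have hpres : φ (adj (P l v) * fockLift P (preservation (mopsT φ P) i (fockVec u))) =
        if l = k then φ (adj (P l v) * (var i * P k u)) else 0 := by
      rw [preservation, fockLift_fockVec]
      simp only [map_sum, map_smul, fockLift_fockVec, Finset.mul_sum, mul_smul_comm, smul_eq_mul]
      split_ifs with hlk
      · subst hlk
        have hv : ∀ w, φ (adj (P l v) * P l w) = if v = w then (sqNorm φ P l v : ℂ) else 0 :=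
          fun w => by rw [hP.orthogonal_same, coe_sqNorm hφ]
        simp only [hv, mul_ite, mul_zero, Finset.sum_ite_eq, Finset.mem_univ, if_true]
        rw [mul_comm, hP.sqNorm_mul_mopsT hφ]
      · exact Finset.sum_eq_zero fun w _ => by rw [hP.orthogonal_of_ne _ _ hlk, mul_zero]
    have hcre : φ (adj (P l v) * fockLift P (creation i (fockVec u))) =
        if k < l then φ (adj (P l v) * (var i * P k u)) else 0 := by
      rw [creation, fockLift_fockVec, fockLift_fockVec]
      split_ifs with hlk
      · rw [hP.adj_mul_var_mul_of_lt i u v hlk]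
      · rw [hP.orthogonal_of_ne _ _ (by omega)]
    rw [mul_sub, map_sub, fockLift_fockVec, fockVar, LinearMap.add_apply, LinearMap.add_apply,
      map_add, map_add, mul_add, mul_add, map_add, map_add, hann, hpres, hcre, sub_eq_zero]
    rcases lt_trichotomy l k with h | h | h
    · simp [h, h.ne, h.not_gt]
    · simp [h]
    · simp [h, h.ne', h.not_gt]

/-- Errors accumulated along a product stay null because they are only multiplied from the left. -/
theorem mul_fockLift_sub_mem_nullIdeal (hP : IsMOPS φ P) (hφ : IsState φ) (p : NCPoly d)
    (v : Fock d) :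
    p * fockLift P v - fockLift P (fockRep (mopsT φ P) (mopsC φ P) p v) ∈ nullIdeal φ := by
  induction p using FreeAlgebra.induction generalizing v with
  | grade0 a =>
    rw [Algebra.algebraMap_eq_smul_one, map_smul, map_one, smul_one_mul, LinearMap.smul_apply,
      map_smul, Module.End.one_apply, sub_self]
    exact zero_mem _
  | grade1 i =>
    have := hP.var_mul_sub_mem_nullIdeal hφ i v
    rwa [← fockRep_var] at this
  | mul p q hp hq =>
    have := add_mem (mul_mem_nullIdeal (hq v) p) (hp (fockRep (mopsT φ P) (mopsC φ P) q v))
    rwa [mul_sub, sub_add_sub_cancel, ← mul_assoc, ← Module.End.mul_apply, ← map_mul] at this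
  | add p q hp hq =>
    have := add_mem (hp v) (hq v)
    rwa [sub_add_sub_comm, ← add_mul, ← map_add, ← LinearMap.add_apply, ← map_add] at this

theorem apply_fockLift (hP : IsMOPS φ P) (hφ : IsState φ) (v : Fock d) :
    φ (fockLift P v) = vacuumCoeff d v := by
  induction v using Fock.induction with
  | zero => simp
  | add v w hv hw => simp only [map_add, hv, hw]
  | smul a v hv => simp only [map_smul, hv]
  | fockVec k u =>
    rw [fockLift_fockVec]
    cases k with
    | zero => rw [hP.monic.zero_eq_one, hφ.unital, fockVec_zero, vacuumCoeff_vacuum]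
    | succ k =>
      have h := hP.orthogonal_of_ne Fin.elim0 u (Nat.succ_ne_zero k).symm
      rwa [hP.monic.zero_eq_one, adj_one, one_mul, ← vacuumCoeff_fockVec_succ u] at h

theorem eq_fockState (hP : IsMOPS φ P) (hφ : IsState φ) :
    φ = fockState (mopsT φ P) (mopsC φ P) := by
  refine LinearMap.ext fun p => ?_
  -- The final `1` is the polynomial against which the null element is tested.
  have h := hP.mul_fockLift_sub_mem_nullIdeal hφ p (vacuum d) 1
  rw [one_mul, map_sub, hP.apply_fockLift hφ, sub_eq_zero, vacuum, fockLift_fockVec,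
    hP.monic.zero_eq_one, mul_one] at h
  exact h

/-- The MOPS witnessing the recursion is `recursionFamily`, not necessarily `P`, which may differ
from it by null polynomials. -/
theorem isRecursionCoeff (hP : IsMOPS φ P) (hφ : IsState φ) :
    IsRecursionCoeff φ (mopsT φ P) (mopsC φ P) :=
  (isRecursionCoeff_iff hφ.unital).2
    ⟨fun _ _ => div_nonneg (sqNorm_nonneg hφ _ _) (sqNorm_nonneg hφ _ _), hP.comm_mopsT hφ,
      hP.eq_fockState hφ⟩

end IsMOPS

theorem IsRecursionCoeff.isState {T : TCoeff d} {C : CCoeff d} (h1 : φ 1 = 1)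
    (h : IsRecursionCoeff φ T C) : IsState φ := by
  obtain ⟨hC, hT, rfl⟩ := (isRecursionCoeff_iff h1).1 h
  exact isState_fockState hC hT

theorem IsRecursionCoeff.hasMOPS {T : TCoeff d} {C : CCoeff d} (h : IsRecursionCoeff φ T C) :
    HasMOPS φ :=
  h.recursion.imp fun _ hP => hP.1

end

end BooleanPower

theorem mainTheorem5 {d : ℕ} (φ : BooleanPower.NCPoly d →ₗ[ℂ] ℂ)
    (hφ : BooleanPower.IsState φ) (hM : BooleanPower.HasMOPS φ) :
    -- the recursion coefficients of the MOPS of `φ` exist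
    (∃ (T : BooleanPower.TCoeff d) (C : BooleanPower.CCoeff d),
      BooleanPower.IsRecursionCoeff φ T C) ∧
    ∀ t : ℝ, 0 ≤ t →
      -- the Boolean convolution power is a state with a MOPS
      BooleanPower.IsState (BooleanPower.boolConvPow φ t) ∧
      BooleanPower.HasMOPS (BooleanPower.boolConvPow φ t) ∧
      -- and its recursion coefficients are those of `φ` with `T_i^{(0)}` and `C^{(1)}` scaled
      ∀ (T : BooleanPower.TCoeff d) (C : BooleanPower.CCoeff d),
        (BooleanPower.IsRecursionCoeff φ T C →
          BooleanPower.IsRecursionCoeff (BooleanPower.boolConvPow φ t)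
            (BooleanPower.scaleT t T) (BooleanPower.scaleC t C)) ∧
        (0 < t →
          BooleanPower.IsRecursionCoeff (BooleanPower.boolConvPow φ t)
            (BooleanPower.scaleT t T) (BooleanPower.scaleC t C) →
          BooleanPower.IsRecursionCoeff φ T C) := by
  obtain ⟨P, hP⟩ := hM
  have h := hP.isRecursionCoeff hφ
  refine ⟨⟨_, _, h⟩, fun t ht => ?_⟩
  have ht' := BooleanPower.isRecursionCoeff_scale hφ.unital ht h
  exact ⟨ht'.isState (BooleanPower.boolConvPow_one φ t), ht'.hasMOPS, fun T C =>
    ⟨BooleanPower.isRecursionCoeff_scale hφ.unital ht,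
      fun ht0 => BooleanPower.isRecursionCoeff_of_scale hφ.unital ht0⟩⟩
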